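/- Let $k$ be an algebraically closed field of characteristic zero. For $n\ge 1$ let $\mathcal A_s(n)$ be the $k$-algebra generated by $u_{ij}$, $1\le i,j\le n$, with relations $$u_{ij}u_{il}=\delta_{jl}u_{ij},\qquad u_{ij}u_{lj}=\delta_{il}u_{ij},\qquad \sum_{l}u_{il}=1=\sum_l u_{li},$$ a Hopf algebra with $\Delta(u_{ij})=\sum_l u_{il}\otimes u_{lj}$, $\epsilon(u_{ij})=\delta_{ij}$, $\mathcal S(u_{ij})=u_{ji}$. A Hopf algebra $H$ over $k$ is a quantum permutation algebra if it is a quotient Hopf algebra of $\mathcal A_s(n)$ for some $n\ge 1$, and its degree $d(H)$ is then the smallest such $n$. Let $(F,\Gamma)$ be a matched pair of finite groups, that is, a left action $\triangleright$ of $\Gamma$ on the set $F$ and a right action $\triangleleft$ of $F$ on the set $\Gamma$ such that $$s\triangleright xy=(s\triangleright x)\big((s\triangleleft x)\triangleright y\big),\qquad st\triangleleft x=\big(s\triangleleft(t\triangleright x)\big)(t\triangleleft x)\qquad(s,t\in\Gamma,\ x,y\in F).$$ Let $H=k^\Gamma\# kF$ be the associated split abelian extension: the Hopf algebra with basis $e_g\#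 x$ ($g\in\Gamma$, $x\in F$) and $$(e_g\# x)(e_h\# y)=\delta_{g\triangleleft x,h}\,e_g\# xy,\qquad \Delta(e_g\# x)=\sum_{st=g}e_s\#(t\triangleright x)\otimes e_t\# x,$$ unit $\sum_g e_g\# 1$ and counit $\epsilon(e_g\# x)=\delta_{g,1}$. Let $\pi:H\to kF$, $\pi(e_g\# x)=\delta_{g,1}x$, be the canonical projection; the extension is cocentral if $\pi(h_1)\otimes h_2=\pi(h_2)\otimes h_1$ for all $h\in H$. A subgroup of $F$ is $\Gamma$-stable if it is stable under $\triangleright$. Theorem. If $F$ is generated by its abelian $\Gamma$-stable subgroups, then $H$ is a quantum permutation algebra and $d(H)\le|\Gamma|\,|F|^2$. In particular, the same conclusion holds if $F$ is abelian, and also if the extension is cocentral (equivalently, if the action $\triangleright$ is trivial). -/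

import Mathlib

open scoped TensorProduct

noncomputable section

/-! ### Magic matrices and the Hopf algebra of the quantum permutation group -/

/-- A square matrix over a ring is magic if the entries of each row (and of each column) are
pairwise orthogonal idempotents that sum to `1`. -/
structure IsMagicMatrix {A : Type*} [Ring A] {n : ℕ} (u : Fin n → Fin n → A) : Prop where
  row_mul : ∀ i j l, u i j * u i l = if j = l then u i j else 0
  col_mul : ∀ i j l, u i j * u l j = if i = l then u i j else 0
  row_sum : ∀ i, ∑ l, u i l = 1
  col_sum : ∀ i, ∑ l, u l i = 1

/-- The defining relations of `A_s(n)` on the free algebra on generators `u_{ij}`: they say that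
the matrix `(u_{ij})` is magic. -/
inductive MagicRel (k : Type*) [Field k] (n : ℕ) :
    FreeAlgebra k (Fin n × Fin n) → FreeAlgebra k (Fin n × Fin n) → Prop
  | row_mul (i j l : Fin n) : MagicRel k n
      (FreeAlgebra.ι k (i, j) * FreeAlgebra.ι k (i, l)) (if j = l then FreeAlgebra.ι k (i, j) else 0)
  | col_mul (i j l : Fin n) : MagicRel k n
      (FreeAlgebra.ι k (i, j) * FreeAlgebra.ι k (l, j)) (if i = l then FreeAlgebra.ι k (i, j) else 0)
  | row_sum (i : Fin n) : MagicRel k n (∑ l, FreeAlgebra.ι k (i, l)) 1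
  | col_sum (i : Fin n) : MagicRel k n (∑ l, FreeAlgebra.ι k (l, i)) 1

/-- Wang's algebra `A_s(n)` over the field `k`: generators `u_{ij}`, `1 ≤ i, j ≤ n`, subject to
the relations that make `(u_{ij})` a magic matrix. -/
def QuantumPerm (k : Type*) [Field k] (n : ℕ) : Type _ := RingQuot (MagicRel k n)

namespace QuantumPerm

variable {k : Type*} [Field k] {n : ℕ}

instance : Ring (QuantumPerm k n) := inferInstanceAs (Ring (RingQuot (MagicRel k n)))

instance : Algebra k (QuantumPerm k n) := inferInstanceAs (Algebra k (RingQuot (MagicRel k n)))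

/-- The canonical map from the free algebra. -/
def mk : FreeAlgebra k (Fin n × Fin n) →ₐ[k] QuantumPerm k n := RingQuot.mkAlgHom k (MagicRel k n)

/-- The generators `u_{ij}`. -/
def u (i j : Fin n) : QuantumPerm k n := mk (FreeAlgebra.ι k (i, j))

theorem isMagicMatrix_u : IsMagicMatrix (u (k := k) (n := n)) where
  row_mul i j l := by
    have h : mk _ = mk _ := RingQuot.mkAlgHom_rel k (MagicRel.row_mul i j l)
    rw [map_mul, apply_ite mk, map_zero] at h
    exact h
  col_mul i j l := by
    have h : mk _ = mk _ := RingQuot.mkAlgHom_rel k (MagicRel.col_mul i j l)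
    rw [map_mul, apply_ite mk, map_zero] at h
    exact h
  row_sum i := by
    have h : mk _ = mk _ := RingQuot.mkAlgHom_rel k (MagicRel.row_sum i)
    rw [map_sum, map_one] at h
    exact h
  col_sum i := by
    have h : mk _ = mk _ := RingQuot.mkAlgHom_rel k (MagicRel.col_sum i)
    rw [map_sum, map_one] at h
    exact h

theorem lift_rel {B : Type*} [Ring B] [Algebra k B] {v : Fin n → Fin n → B}
    (hv : IsMagicMatrix v) ⦃x y : FreeAlgebra k (Fin n × Fin n)⦄ (h : MagicRel k n x y) :
    FreeAlgebra.lift k (fun p : Fin n × Fin n => v p.1 p.2) x =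
      FreeAlgebra.lift k (fun p : Fin n × Fin n => v p.1 p.2) y := by
  cases h with
  | row_mul i j l =>
    have h := hv.row_mul i j l
    split_ifs at h ⊢ <;> simpa using h
  | col_mul i j l =>
    have h := hv.col_mul i j l
    split_ifs at h ⊢ <;> simpa using h
  | row_sum i => simpa using hv.row_sum i
  | col_sum i => simpa using hv.col_sum i

/-- The universal property of `A_s(n)`: a magic matrix over a `k`-algebra `B` gives an algebra
map `A_s(n) → B`. -/
def lift {B : Type*} [Ring B] [Algebra k B] (v : Fin n → Fin n → B) (hv : IsMagicMatrix v) :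
    QuantumPerm k n →ₐ[k] B :=
  RingQuot.liftAlgHom k ⟨FreeAlgebra.lift k fun p => v p.1 p.2, lift_rel hv⟩

@[simp]
theorem lift_u {B : Type*} [Ring B] [Algebra k B] (v : Fin n → Fin n → B) (hv : IsMagicMatrix v)
    (i j : Fin n) : lift v hv (u i j : QuantumPerm k n) = v i j := by
  have h := RingQuot.liftAlgHom_mkAlgHom_apply k (FreeAlgebra.lift k fun p => v p.1 p.2)
    (lift_rel hv) (FreeAlgebra.ι k (i, j))
  rw [FreeAlgebra.lift_ι_apply] at h
  exact h

theorem algHom_ext {B : Type*} [Ring B] [Algebra k B] {f g : QuantumPerm k n →ₐ[k] B}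
    (h : ∀ i j, f (u i j) = g (u i j)) : f = g := by
  refine RingQuot.ringQuot_ext' k (s := MagicRel k n) f g ?_
  refine FreeAlgebra.hom_ext ?_
  funext p
  exact h p.1 p.2

/-- The algebra map `Δ(u_{ij}) = ∑_l u_{il} ⊗ u_{lj}`. -/
def comulHom (k : Type*) [Field k] (n : ℕ) :
    QuantumPerm k n →ₐ[k] QuantumPerm k n ⊗[k] QuantumPerm k n :=
  lift (fun i j => ∑ l, u i l ⊗ₜ[k] u l j)
    { row_mul := by
        intro i j l
        simp only [Finset.sum_mul_sum, Algebra.TensorProduct.tmul_mul_tmul,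
          isMagicMatrix_u.row_mul, TensorProduct.ite_tmul]
        simp only [Finset.sum_ite_eq, Finset.mem_univ, if_true, isMagicMatrix_u.row_mul]
        split_ifs <;> simp
      col_mul := by
        intro i j l
        simp only [Finset.sum_mul_sum, Algebra.TensorProduct.tmul_mul_tmul,
          isMagicMatrix_u.col_mul, TensorProduct.tmul_ite]
        simp only [Finset.sum_ite_eq, Finset.mem_univ, if_true, isMagicMatrix_u.col_mul]
        split_ifs <;> simp
      row_sum := by
        intro i
        rw [Finset.sum_comm]
        simp only [← TensorProduct.tmul_sum, isMagicMatrix_u.row_sum, ← TensorProduct.sum_tmul]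
        rfl
      col_sum := by
        intro i
        rw [Finset.sum_comm]
        simp only [← TensorProduct.sum_tmul, isMagicMatrix_u.col_sum, ← TensorProduct.tmul_sum]
        rfl }

/-- The algebra map `ε(u_{ij}) = δ_{ij}`. -/
def counitHom (k : Type*) [Field k] (n : ℕ) : QuantumPerm k n →ₐ[k] k :=
  lift (fun i j => if i = j then 1 else 0)
    { row_mul := by intro i j l; split_ifs <;> simp_all
      col_mul := by intro i j l; split_ifs <;> simp_all
      row_sum := by intro i; simp
      col_sum := by intro i; simp }

/-- The algebra map `A_s(n) → A_s(n)ᵐᵒᵖ` with `u_{ij} ↦ u_{ji}`. -/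
def antipodeHom (k : Type*) [Field k] (n : ℕ) : QuantumPerm k n →ₐ[k] (QuantumPerm k n)ᵐᵒᵖ :=
  lift (fun i j => MulOpposite.op (u j i))
    { row_mul := by
        intro i j l
        rw [← MulOpposite.op_mul, isMagicMatrix_u.col_mul]
        split_ifs <;> simp_all
      col_mul := by
        intro i j l
        rw [← MulOpposite.op_mul, isMagicMatrix_u.row_mul]
        split_ifs <;> simp_all
      row_sum := by
        intro i
        rw [← Finset.op_sum, isMagicMatrix_u.col_sum, MulOpposite.op_one]
      col_sum := by
        intro i
        rw [← Finset.op_sum, isMagicMatrix_u.row_sum, MulOpposite.op_one] }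

/-- The bialgebra structure of `A_s(n)`. -/
instance : Bialgebra k (QuantumPerm k n) :=
  Bialgebra.ofAlgHom (comulHom k n) (counitHom k n)
    (by
      refine algHom_ext fun i j => ?_
      simp only [comulHom, AlgHom.comp_apply, lift_u, map_sum, Algebra.TensorProduct.map_tmul,
        AlgHom.id_apply, TensorProduct.sum_tmul, TensorProduct.tmul_sum]
      rw [Finset.sum_comm]
      rfl)
    (by
      refine algHom_ext fun i j => ?_
      simp [comulHom, counitHom, TensorProduct.ite_tmul])
    (by
      refine algHom_ext fun i j => ?_
      simp [comulHom, counitHom, TensorProduct.tmul_ite])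

theorem comul_u (i j : Fin n) :
    Coalgebra.comul (R := k) (u i j : QuantumPerm k n) = ∑ l, u i l ⊗ₜ[k] u l j :=
  lift_u _ _ i j

theorem counit_u (i j : Fin n) :
    Coalgebra.counit (R := k) (u i j : QuantumPerm k n) = if i = j then 1 else 0 :=
  lift_u _ _ i j

theorem induction {P : QuantumPerm k n → Prop} (halg : ∀ r, P (algebraMap k _ r))
    (hu : ∀ i j, P (u i j)) (hmul : ∀ a b, P a → P b → P (a * b))
    (hadd : ∀ a b, P a → P b → P (a + b)) (a : QuantumPerm k n) : P a := by
  obtain ⟨x, rfl⟩ : ∃ x, mk x = a := RingQuot.mkAlgHom_surjective k (MagicRel k n) a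
  induction x using FreeAlgebra.induction with
  | grade0 r => rw [AlgHom.commutes]; exact halg r
  | grade1 p => exact hu p.1 p.2
  | mul a b ha hb => rw [map_mul]; exact hmul _ _ ha hb
  | add a b ha hb => rw [map_add]; exact hadd _ _ ha hb

/-- The antipode of `A_s(n)`: the anti-automorphism `S(u_{ij}) = u_{ji}`. -/
def antipodeLin (k : Type*) [Field k] (n : ℕ) : QuantumPerm k n →ₗ[k] QuantumPerm k n :=
  (MulOpposite.opLinearEquiv k).symm.toLinearMap ∘ₗ (antipodeHom k n).toLinearMap

theorem antipodeLin_u (i j : Fin n) : antipodeLin k n (u i j) = u j i := by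
  simp [antipodeLin, antipodeHom]

theorem antipodeLin_mul (a b : QuantumPerm k n) :
    antipodeLin k n (a * b) = antipodeLin k n b * antipodeLin k n a := by
  simp [antipodeLin]

theorem antipodeLin_algebraMap (r : k) :
    antipodeLin k n (algebraMap k _ r) = algebraMap k _ r := by
  simp [antipodeLin]

/-- The Hopf algebra structure of `A_s(n)`. -/
instance : HopfAlgebra k (QuantumPerm k n) where
  antipode := antipodeLin k n
  mul_antipode_rTensor_comul := by
    ext a
    simp only [LinearMap.comp_apply, Algebra.linearMap_apply]
    induction a using induction with
    | halg r =>
      simp only [Bialgebra.comul_algebraMap, Bialgebra.counit_algebraMap,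
        Algebra.TensorProduct.algebraMap_apply, LinearMap.rTensor_tmul, LinearMap.mul'_apply,
        antipodeLin_algebraMap, mul_one]
    | hu i j =>
      simp only [comul_u, counit_u, map_sum, LinearMap.rTensor_tmul, LinearMap.mul'_apply,
        antipodeLin_u, isMagicMatrix_u.row_mul]
      by_cases h : i = j
      · subst h; simp [isMagicMatrix_u.col_sum]
      · simp [h]
    | hmul a b ha hb =>
      have key : ∀ x y : QuantumPerm k n ⊗[k] QuantumPerm k n, ∀ r : k,
          LinearMap.mul' k _ ((antipodeLin k n).rTensor _ x) = algebraMap k _ r →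
          LinearMap.mul' k _ ((antipodeLin k n).rTensor _ (x * y)) =
            algebraMap k _ r * LinearMap.mul' k _ ((antipodeLin k n).rTensor _ y) := by
        intro x y r hx
        induction y using TensorProduct.induction_on with
        | zero => simp
        | add y z hy hz => simp only [mul_add, map_add, hy, hz]
        | tmul c d =>
          have : LinearMap.mul' k _ ((antipodeLin k n).rTensor _ (x * (c ⊗ₜ d))) =
              antipodeLin k n c * LinearMap.mul' k _ ((antipodeLin k n).rTensor _ x) * d := by
            clear hx
            induction x using TensorProduct.induction_on with
            | zero => simp
            | add x z hx hz => simp only [add_mul, mul_add, map_add, hx, hz]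
            | tmul a b => simp [antipodeLin_mul, mul_assoc]
          rw [this, hx, ← Algebra.commutes, mul_assoc]
          simp
      rw [Bialgebra.comul_mul, key _ _ _ ha, hb, Bialgebra.counit_mul, map_mul]
    | hadd a b ha hb => simp only [map_add, ha, hb]
  mul_antipode_lTensor_comul := by
    ext a
    simp only [LinearMap.comp_apply, Algebra.linearMap_apply]
    induction a using induction with
    | halg r =>
      simp only [Bialgebra.comul_algebraMap, Bialgebra.counit_algebraMap,
        Algebra.TensorProduct.algebraMap_apply, LinearMap.lTensor_tmul, LinearMap.mul'_apply]
      rw [← map_one (algebraMap k (QuantumPerm k n)), antipodeLin_algebraMap, map_one, mul_one]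
    | hu i j =>
      simp only [comul_u, counit_u, map_sum, LinearMap.lTensor_tmul, LinearMap.mul'_apply,
        antipodeLin_u, isMagicMatrix_u.col_mul]
      by_cases h : i = j
      · subst h; simp [isMagicMatrix_u.row_sum]
      · simp [h]
    | hmul a b ha hb =>
      have key : ∀ x y : QuantumPerm k n ⊗[k] QuantumPerm k n, ∀ r : k,
          LinearMap.mul' k _ ((antipodeLin k n).lTensor _ y) = algebraMap k _ r →
          LinearMap.mul' k _ ((antipodeLin k n).lTensor _ (x * y)) =
            LinearMap.mul' k _ ((antipodeLin k n).lTensor _ x) * algebraMap k _ r := by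
        intro x y r hy
        induction x using TensorProduct.induction_on with
        | zero => simp
        | add y z hy hz => simp only [add_mul, map_add, hy, hz]
        | tmul c d =>
          have : LinearMap.mul' k _ ((antipodeLin k n).lTensor _ ((c ⊗ₜ d) * y)) =
              c * LinearMap.mul' k _ ((antipodeLin k n).lTensor _ y) * antipodeLin k n d := by
            clear hy
            induction y using TensorProduct.induction_on with
            | zero => simp
            | add x z hx hz => simp only [add_mul, mul_add, map_add, hx, hz]
            | tmul a b => simp [antipodeLin_mul, mul_assoc]
          rw [this, hy, mul_assoc, Algebra.commutes, ← mul_assoc]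
          simp
      rw [Bialgebra.comul_mul, key _ _ _ hb, ha, Bialgebra.counit_mul, map_mul]
    | hadd a b ha hb => simp only [map_add, ha, hb]

theorem antipode_u (i j : Fin n) :
    HopfAlgebra.antipode k (u i j : QuantumPerm k n) = u j i :=
  antipodeLin_u i j

end QuantumPerm

/-- `H` is a quotient Hopf algebra of `A_s(n)`: there is a surjective bialgebra map
`A_s(n) → H`. (A bialgebra map between Hopf algebras commutes with the antipodes.) -/
def IsQuotientOfQuantumPerm (k : Type*) [Field k] (H : Type*) [Ring H] [HopfAlgebra k H]
    (n : ℕ) : Prop :=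
  ∃ f : QuantumPerm k n →ₐc[k] H, Function.Surjective f

/-- `H` is a quantum permutation algebra: a quotient Hopf algebra of `A_s(n)` for some `n ≥ 1`. -/
def IsQuantumPermutationAlgebra (k : Type*) [Field k] (H : Type*) [Ring H] [HopfAlgebra k H] :
    Prop :=
  ∃ n : ℕ, 1 ≤ n ∧ IsQuotientOfQuantumPerm k H n

/-- The degree `d(H)` of a quantum permutation algebra: the smallest `n ≥ 1` such that `H` is a
quotient Hopf algebra of `A_s(n)`. (Only meaningful if `H` is a quantum permutation algebra.) -/
def quantumPermDegree (k : Type*) [Field k] (H : Type*) [Ring H] [HopfAlgebra k H] : ℕ :=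
  sInf {n : ℕ | 1 ≤ n ∧ IsQuotientOfQuantumPerm k H n}

/-! ### Matched pairs of groups -/

/-- A matched pair `(F, Γ)` of groups: a left action `▷` of `Γ` on the set `F` and a right action
`◁` of `F` on the set `Γ` such that `s ▷ xy = (s ▷ x)((s ◁ x) ▷ y)` and
`st ◁ x = (s ◁ (t ▷ x))(t ◁ x)`. -/
structure MatchedPair (F Γ : Type*) [Group F] [Group Γ] where
  /-- `lact s x` is `s ▷ x`. -/
  lact : Γ → F → F
  /-- `ract s x` is `s ◁ x`. -/
  ract : Γ → F → Γ
  one_lact : ∀ x, lact 1 x = x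
  mul_lact : ∀ s t x, lact (s * t) x = lact s (lact t x)
  ract_one : ∀ s, ract s 1 = s
  ract_mul : ∀ s x y, ract s (x * y) = ract (ract s x) y
  lact_mul : ∀ s x y, lact s (x * y) = lact s x * lact (ract s x) y
  mul_ract : ∀ s t x, ract (s * t) x = ract s (lact t x) * ract t x

namespace MatchedPair

variable {F Γ : Type*} [Group F] [Group Γ] (m : MatchedPair F Γ)

theorem lact_one (s : Γ) : m.lact s 1 = 1 := by
  have h := m.lact_mul s 1 1
  rw [mul_one, m.ract_one] at h
  exact (mul_eq_left.mp h.symm)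

theorem one_ract (x : F) : m.ract 1 x = 1 := by
  have h := m.mul_ract 1 1 x
  rw [mul_one, m.one_lact] at h
  exact (mul_eq_left.mp h.symm)

theorem lact_inv (s : Γ) (x : F) : m.lact (m.ract s x) x⁻¹ = (m.lact s x)⁻¹ := by
  have h := m.lact_mul s x x⁻¹
  rw [mul_inv_cancel, m.lact_one] at h
  exact (inv_eq_of_mul_eq_one_right h.symm).symm

theorem inv_ract (s : Γ) (x : F) : m.ract s⁻¹ (m.lact s x) = (m.ract s x)⁻¹ := by
  have h := m.mul_ract s⁻¹ s x
  rw [inv_mul_cancel, m.one_ract] at h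
  exact (inv_eq_of_mul_eq_one_left h.symm).symm

/-- The permutation `s ↦ s ◁ x` of `Γ`. -/
def ractEquiv (x : F) : Γ ≃ Γ where
  toFun s := m.ract s x
  invFun s := m.ract s x⁻¹
  left_inv s := by simp only [← m.ract_mul, mul_inv_cancel, m.ract_one]
  right_inv s := by simp only [← m.ract_mul, inv_mul_cancel, m.ract_one]

/-- A subgroup `T` of `F` is `Γ`-stable if it is stable under the action `▷` of `Γ`. -/
def IsStable (T : Subgroup F) : Prop := ∀ (s : Γ), ∀ x ∈ T, m.lact s x ∈ T

end MatchedPair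

/-! ### The split abelian extension `k^Γ # kF` -/

/-- The vector space underlying `k^Γ # kF`, i.e. `k^Γ ⊗ kF`, as the vector space with basis
`e_g # x`, `(g, x) ∈ Γ × F`, where `e_g` is the indicator function of `g`. -/
@[nolint unusedArguments]
def SplitExtension (k : Type*) [Field k] {F Γ : Type*} [Group F] [Group Γ]
    (_m : MatchedPair F Γ) : Type _ := Γ × F →₀ k

namespace SplitExtension

variable {k : Type*} [Field k] {F Γ : Type*} [Group F] [Group Γ] {m : MatchedPair F Γ}

instance : AddCommGroup (SplitExtension k m) := inferInstanceAs (AddCommGroup (Γ × F →₀ k))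

instance : Module k (SplitExtension k m) := inferInstanceAs (Module k (Γ × F →₀ k))

/-- The basis vector `e_g # x`. -/
def e (g : Γ) (x : F) : SplitExtension k m := Finsupp.single (g, x) (1 : k)

/-- The linear map that sends the basis vector `e_g # x` to `v g x`. -/
def linearLift {V : Type*} [AddCommGroup V] [Module k V] (v : Γ → F → V) :
    SplitExtension k m →ₗ[k] V :=
  Finsupp.linearCombination k fun p : Γ × F => v p.1 p.2

@[simp]
theorem linearLift_e {V : Type*} [AddCommGroup V] [Module k V] (v : Γ → F → V) (g : Γ) (x : F) :
    linearLift v (e g x : SplitExtension k m) = v g x :=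
  (Finsupp.linearCombination_single k (1 : k) (g, x)).trans (one_smul k _)

theorem linearMap_ext {V : Type*} [AddCommGroup V] [Module k V]
    {f f' : SplitExtension k m →ₗ[k] V} (h : ∀ g x, f (e g x) = f' (e g x)) : f = f' :=
  Finsupp.lhom_ext' fun p => LinearMap.ext_ring (h p.1 p.2)

theorem linearMap_ext₂ {V : Type*} [AddCommGroup V] [Module k V]
    {f f' : SplitExtension k m →ₗ[k] SplitExtension k m →ₗ[k] V}
    (h : ∀ g x g' x', f (e g x) (e g' x') = f' (e g x) (e g' x')) : f = f' :=
  linearMap_ext fun g x => linearMap_ext fun g' x' => h g x g' x'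

open Classical in
/-- The bilinear multiplication `(e_g # x)(e_h # y) = δ_{g ◁ x, h} e_g # xy`. -/
def mulLin (k : Type*) [Field k] (m : MatchedPair F Γ) :
    SplitExtension k m →ₗ[k] SplitExtension k m →ₗ[k] SplitExtension k m :=
  linearLift fun g x => linearLift fun h y => if m.ract g x = h then e g (x * y) else 0

open Classical in
theorem mulLin_e (g h : Γ) (x y : F) : mulLin k m (e g x) (e h y) =
    if m.ract g x = h then e g (x * y) else 0 := by
  simp [mulLin]

theorem mulLin_assoc (a b c : SplitExtension k m) :
    mulLin k m (mulLin k m a b) c = mulLin k m a (mulLin k m b c) := by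
  classical
  have h : (mulLin k m).compr₂ (mulLin k m) =
      (LinearMap.llcomp k _ _ _).flip (mulLin k m) ∘ₗ
        LinearMap.llcomp k (SplitExtension k m) _ (SplitExtension k m) ∘ₗ mulLin k m := by
    refine linearMap_ext₂ fun g x g' x' => linearMap_ext fun g'' x'' => ?_
    simp only [LinearMap.compr₂_apply, LinearMap.comp_apply, LinearMap.flip_apply,
      LinearMap.llcomp_apply, mulLin_e]
    by_cases h1 : m.ract g x = g'
    · subst h1
      by_cases h2 : m.ract (m.ract g x) x' = g''
      · simp [mulLin_e, h2, m.ract_mul, mul_assoc]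
      · simp [mulLin_e, h2, m.ract_mul]
    · by_cases h2 : m.ract g' x' = g''
      · simp [mulLin_e, h1, h2]
      · simp [h1, h2]
  exact congr($h a b c)

variable [Fintype Γ]

/-- The unit `1 = ∑_g e_g # 1`. -/
def unit (k : Type*) [Field k] (m : MatchedPair F Γ) : SplitExtension k m := ∑ g, e g 1

theorem unit_mulLin (a : SplitExtension k m) : mulLin k m (unit k m) a = a := by
  classical
  have h : mulLin k m (unit k m) = LinearMap.id :=
    linearMap_ext fun g x => by
      simp [unit, map_sum, LinearMap.sum_apply, mulLin_e, m.ract_one]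
  exact congr($h a)

theorem mulLin_unit (a : SplitExtension k m) : mulLin k m a (unit k m) = a := by
  classical
  have h : (mulLin k m).flip (unit k m) = LinearMap.id :=
    linearMap_ext fun g x => by simp [unit, map_sum, mulLin_e]
  exact congr($h a)

instance : Ring (SplitExtension k m) :=
  { (inferInstance : AddCommGroup (SplitExtension k m)) with
    mul := fun a b => mulLin k m a b
    one := unit k m
    left_distrib := fun a b c => map_add (mulLin k m a) b c
    right_distrib := fun a b c => LinearMap.map_add₂ (mulLin k m) a b c
    zero_mul := fun a => LinearMap.map_zero₂ (mulLin k m) a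
    mul_zero := fun a => map_zero (mulLin k m a)
    mul_assoc := mulLin_assoc
    one_mul := unit_mulLin
    mul_one := mulLin_unit }

theorem mul_def (a b : SplitExtension k m) : a * b = mulLin k m a b := rfl

theorem one_def : (1 : SplitExtension k m) = ∑ g, e g 1 := rfl

instance : Algebra k (SplitExtension k m) :=
  Algebra.ofModule (fun r a b => LinearMap.map_smul₂ (mulLin k m) r a b)
    (fun r a b => map_smul (mulLin k m a) r b)

open Classical in
theorem e_mul_e (g h : Γ) (x y : F) : (e g x * e h y : SplitExtension k m) =
    if m.ract g x = h then e g (x * y) else 0 :=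
  mulLin_e g h x y

/-- The comultiplication `Δ(e_g # x) = ∑_{st = g} e_s # (t ▷ x) ⊗ e_t # x`; the sum runs over
`t ∈ Γ`, with `s = g t⁻¹`. -/
def comulLin (k : Type*) [Field k] (m : MatchedPair F Γ) :
    SplitExtension k m →ₗ[k] SplitExtension k m ⊗[k] SplitExtension k m :=
  linearLift fun g x => ∑ t : Γ, e (g * t⁻¹) (m.lact t x) ⊗ₜ[k] e t x

open Classical in
/-- The counit `ε(e_g # x) = δ_{g, 1}`. -/
def counitLin (k : Type*) [Field k] (m : MatchedPair F Γ) : SplitExtension k m →ₗ[k] k :=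
  linearLift fun g _ => if g = 1 then 1 else 0

instance : Coalgebra k (SplitExtension k m) where
  comul := comulLin k m
  counit := counitLin k m
  coassoc := by
    refine linearMap_ext fun g x => ?_
    simp only [LinearMap.comp_apply, comulLin, linearLift_e, map_sum, LinearMap.rTensor_tmul,
      LinearMap.lTensor_tmul, TensorProduct.sum_tmul, TensorProduct.tmul_sum,
      LinearEquiv.coe_coe, TensorProduct.assoc_tmul]
    conv_rhs => rw [Finset.sum_comm]
    refine Finset.sum_congr rfl fun t _ => ?_
    refine Fintype.sum_equiv (Equiv.mulRight t) _ _ fun u => ?_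
    simp [m.mul_lact, mul_assoc]
  rTensor_counit_comp_comul := by
    classical
    refine linearMap_ext fun g x => ?_
    simp only [LinearMap.comp_apply, comulLin, counitLin, linearLift_e, map_sum,
      LinearMap.rTensor_tmul, TensorProduct.ite_tmul, mul_inv_eq_one, TensorProduct.mk_apply]
    simp
  lTensor_counit_comp_comul := by
    classical
    refine linearMap_ext fun g x => ?_
    simp only [LinearMap.comp_apply, comulLin, counitLin, linearLift_e, map_sum,
      LinearMap.lTensor_tmul, TensorProduct.tmul_ite]
    simp [m.one_lact]

theorem comul_e (g : Γ) (x : F) : Coalgebra.comul (R := k) (e g x : SplitExtension k m) =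
    ∑ t : Γ, e (g * t⁻¹) (m.lact t x) ⊗ₜ[k] e t x :=
  linearLift_e _ g x

open Classical in
theorem counit_e (g : Γ) (x : F) :
    Coalgebra.counit (R := k) (e g x : SplitExtension k m) = if g = 1 then 1 else 0 :=
  linearLift_e _ g x

instance : Bialgebra k (SplitExtension k m) where
  counit_one := by
    classical
    simp [one_def, counit_e]
  mul_compr₂_counit := by
    classical
    refine linearMap_ext₂ fun g x h y => ?_
    simp only [LinearMap.compr₂_apply, LinearMap.compl₁₂_apply, LinearMap.mul_apply', e_mul_e,
      counit_e, apply_ite (Coalgebra.counit (R := k) (A := SplitExtension k m)), map_zero]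
    by_cases hg : g = 1
    · subst hg; simp [m.one_ract, eq_comm]
    · simp [hg]
  comul_one := by
    rw [Algebra.TensorProduct.one_def, one_def, map_sum, TensorProduct.sum_tmul]
    simp only [comul_e, m.lact_one, TensorProduct.tmul_sum]
    rw [Finset.sum_comm]
    conv_rhs => rw [Finset.sum_comm]
    refine Finset.sum_congr rfl fun t _ => ?_
    exact Fintype.sum_equiv (Equiv.mulRight t⁻¹) _ _ fun u => rfl
  mul_compr₂_comul := by
    classical
    refine linearMap_ext₂ fun g x h y => ?_
    simp only [LinearMap.compr₂_apply, LinearMap.compl₁₂_apply, LinearMap.mul_apply', e_mul_e,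
      comul_e, apply_ite (Coalgebra.comul (R := k) (A := SplitExtension k m)), map_zero,
      Finset.sum_mul_sum, Algebra.TensorProduct.tmul_mul_tmul, TensorProduct.tmul_ite,
      Finset.sum_ite_eq, Finset.mem_univ, if_true]
    have hc : ∀ t, m.ract (g * t⁻¹) (m.lact t x) = h * (m.ract t x)⁻¹ ↔ m.ract g x = h := by
      intro t
      rw [eq_mul_inv_iff_mul_eq, ← m.mul_ract, inv_mul_cancel_right]
    simp only [hc, m.lact_mul]
    split_ifs <;> simp

/-- The antipode `S(e_g # x) = e_{(g ◁ x)⁻¹} # (g ▷ x)⁻¹`. -/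
def antipodeLin (k : Type*) [Field k] (m : MatchedPair F Γ) :
    SplitExtension k m →ₗ[k] SplitExtension k m :=
  linearLift fun g x => e (m.ract g x)⁻¹ (m.lact g x)⁻¹

instance : HopfAlgebra k (SplitExtension k m) where
  antipode := antipodeLin k m
  mul_antipode_rTensor_comul := by
    classical
    refine linearMap_ext fun g x => ?_
    simp only [LinearMap.comp_apply, comul_e, counit_e, map_sum, LinearMap.rTensor_tmul,
      antipodeLin, linearLift_e, LinearMap.mul'_apply, e_mul_e, Algebra.linearMap_apply]
    have hc : ∀ t, m.ract (m.ract (g * t⁻¹) (m.lact t x))⁻¹ (m.lact (g * t⁻¹) (m.lact t x))⁻¹ = t ↔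
        g = 1 := by
      intro t
      rw [← m.inv_ract, ← m.ract_mul, mul_inv_cancel, m.ract_one]
      simp
    simp only [hc]
    by_cases hg : g = 1
    · subst hg
      simp only [if_true, one_mul, map_one, m.inv_ract, inv_inv, ← m.mul_lact, inv_mul_cancel,
        m.one_lact, one_def]
      exact Fintype.sum_equiv (m.ractEquiv x) _ _ fun t => rfl
    · simp [hg]
  mul_antipode_lTensor_comul := by
    classical
    refine linearMap_ext fun g x => ?_
    simp only [LinearMap.comp_apply, comul_e, counit_e, map_sum, LinearMap.lTensor_tmul,
      antipodeLin, linearLift_e, LinearMap.mul'_apply, e_mul_e, Algebra.linearMap_apply]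
    have hc : ∀ t, m.ract (g * t⁻¹) (m.lact t x) = (m.ract t x)⁻¹ ↔ g = 1 := by
      intro t
      rw [eq_inv_iff_mul_eq_one, ← m.mul_ract, inv_mul_cancel_right]
      exact ⟨fun h => (m.ractEquiv x).injective (h.trans (m.one_ract x).symm),
        fun h => h ▸ m.one_ract x⟩
    simp only [hc]
    by_cases hg : g = 1
    · subst hg
      simp only [if_true, one_mul, map_one, mul_inv_cancel, one_def]
      exact Fintype.sum_equiv (Equiv.inv Γ) _ _ fun t => rfl
    · simp [hg]

open Classical in
/-- The linear map `ε ⊗ id : k^Γ # kF → kF`, `e_g # x ↦ δ_{g, 1} x`. -/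
def projLin (k : Type*) [Field k] (m : MatchedPair F Γ) :
    SplitExtension k m →ₗ[k] MonoidAlgebra k F :=
  linearLift fun g x => if g = 1 then MonoidAlgebra.single x (1 : k) else 0

open Classical in
theorem projLin_e (g : Γ) (x : F) : projLin k m (e g x) =
    if g = 1 then MonoidAlgebra.single x (1 : k) else 0 :=
  linearLift_e _ g x

/-- The canonical projection `π = ε ⊗ id : k^Γ # kF → kF`, `π(e_g # x) = δ_{g, 1} x`. -/
def proj (k : Type*) [Field k] (m : MatchedPair F Γ) : SplitExtension k m →ₐc[k] MonoidAlgebra k F :=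
  BialgHom.ofAlgHom
    (AlgHom.ofLinearMap
      (projLin k m)
      (by
        classical
        simp [one_def, projLin_e, MonoidAlgebra.one_def])
      (by
        classical
        intro a b
        have h : (LinearMap.mul k (SplitExtension k m)).compr₂
              (projLin k m) =
            (LinearMap.mul k (MonoidAlgebra k F)).compl₁₂
              (projLin k m)
              (projLin k m) := by
          refine linearMap_ext₂ fun g x h y => ?_
          simp only [LinearMap.compr₂_apply, LinearMap.compl₁₂_apply, LinearMap.mul_apply',
            e_mul_e, projLin_e]
          by_cases hg : g = 1
          · subst hg
            by_cases hh : 1 = h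
            · subst hh; simp [projLin_e, m.one_ract, MonoidAlgebra.single_mul_single]
            · simp [m.one_ract, hh, Ne.symm hh]
          · split_ifs <;> simp [projLin_e, hg]
        exact congr($h a b)))
    (by
      refine AlgHom.toLinearMap_injective (linearMap_ext fun g x => ?_)
      by_cases hg : g = 1 <;> simp [counit_e, projLin_e, hg])
    (by
      classical
      refine AlgHom.toLinearMap_injective (linearMap_ext fun g x => ?_)
      simp only [AlgHom.comp_toLinearMap, LinearMap.comp_apply, AlgHom.toLinearMap_apply,
        Bialgebra.comulAlgHom_apply, comul_e, map_sum, Algebra.TensorProduct.map_tmul,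
        AlgHom.ofLinearMap_apply, projLin_e, TensorProduct.tmul_ite, TensorProduct.ite_tmul]
      by_cases hg : g = 1 <;> simp [hg, m.one_lact])

open Classical in
theorem proj_e (g : Γ) (x : F) : proj k m (e g x) =
    if g = 1 then MonoidAlgebra.single x (1 : k) else 0 :=
  projLin_e g x

end SplitExtension

/-- A coalgebra map `π : H → C` is cocentral if `π(h₁) ⊗ h₂ = π(h₂) ⊗ h₁` for all `h`. -/
def IsCocentral {k H C : Type*} [Field k] [AddCommGroup H] [Module k H] [Coalgebra k H]
    [AddCommGroup C] [Module k C] [Coalgebra k C] (π : H →ₗc[k] C) : Prop :=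
  ∀ h : H, π.toLinearMap.rTensor H (Coalgebra.comul h) =
    π.toLinearMap.rTensor H (TensorProduct.comm k H H (Coalgebra.comul h))

end

/-! A magic comatrix of size n in H is the same datum as a Hopf algebra map from `QuantumPerm k n`
to H, and the image is the subalgebra generated by the entries. Block diagonal sums of magic
comatrices are again magic comatrices: sizes add and generated subalgebras join. Hence it suffices
to cover a generating set of H by the entries of a few magic comatrices.

The functions e_g # 1 come from Γ translating itself, with size |Γ|. For an abelian stable subgroup
T, the elements a_{y,x} = ∑_{t ▷ x = y} e_t # x with x, y in T form a comatrix. The character table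
of T changes its basis to `charMatrix`. This is the matrix of the coaction on kT ≅ k^{T^}, with T^
the character group. Orthogonality of characters and s ▷ xy = (s ▷ x)((s ◁ x) ▷ y) make it magic,
and |T^| = |T| gives its size. Fourier inversion (`sum_char_smul_charMatrix`) recovers 1 # x for x
in T from the row of the trivial character.

If such T generate F, fewer than |F| of them do (`exists_finset_sup_eq_top`), so the total size is
at most |Γ| + (|F| - 1)|F| ≤ |Γ| |F|². If F is abelian, T = F works; if ▷ is trivial, the cyclic
subgroups work. -/

/-! ### Magic comatrices -/

/-- A magic comatrix of a Hopf algebra: a matrix `u` with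
`Δ(u_{ij}) = ∑_l u_{il} ⊗ u_{lj}` and `ε(u_{ij}) = δ_{ij}`, whose rows are partitions of unity into
orthogonal idempotents and whose transpose is its image under the antipode. -/
structure IsMagicComatrix (k : Type*) [Field k] {H : Type*} [Ring H] [HopfAlgebra k H]
    {ι : Type*} [Fintype ι] [DecidableEq ι] (u : ι → ι → H) : Prop where
  row_mul : ∀ i j l, u i j * u i l = if j = l then u i j else 0
  row_sum : ∀ i, ∑ l, u i l = 1
  comul : ∀ i j, Coalgebra.comul (R := k) (u i j) = ∑ l, u i l ⊗ₜ[k] u l j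
  counit : ∀ i j, Coalgebra.counit (R := k) (u i j) = if i = j then 1 else 0
  antipode : ∀ i j, HopfAlgebra.antipode k (u i j) = u j i

namespace IsMagicComatrix

variable {k : Type*} [Field k] {H : Type*} [Ring H] [HopfAlgebra k H]
  {ι κ : Type*} [Fintype ι] [DecidableEq ι] [Fintype κ] [DecidableEq κ]

theorem reindex {u : ι → ι → H} (hu : IsMagicComatrix k u) (σ : κ ≃ ι) :
    IsMagicComatrix k fun i j => u (σ i) (σ j) where
  row_mul i j l := by simp [hu.row_mul]
  row_sum i := (σ.sum_comp fun l => u (σ i) l).trans (hu.row_sum _)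
  comul i j := (hu.comul _ _).trans (σ.sum_comp fun l => u (σ i) l ⊗ₜ[k] u l (σ j)).symm
  counit i j := by simp [hu.counit]
  antipode i j := hu.antipode _ _

theorem fromBlocks {u : ι → ι → H} {v : κ → κ → H} (hu : IsMagicComatrix k u)
    (hv : IsMagicComatrix k v) : IsMagicComatrix k (Matrix.fromBlocks u 0 0 v) where
  row_mul := by
    rintro (i | i) (j | j) (l | l) <;>
      simp [Matrix.fromBlocks, Matrix.of_apply, hu.row_mul, hv.row_mul]
  row_sum := by
    rintro (i | i) <;> simp [Matrix.fromBlocks, Matrix.of_apply, hu.row_sum, hv.row_sum]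
  comul := by
    rintro (i | i) (j | j) <;> simp [Matrix.fromBlocks, Matrix.of_apply, hu.comul, hv.comul]
  counit := by
    rintro (i | i) (j | j) <;> simp [Matrix.fromBlocks, Matrix.of_apply, hu.counit, hv.counit]
  antipode := by
    rintro (i | i) (j | j) <;> simp [Matrix.fromBlocks, Matrix.of_apply, hu.antipode, hv.antipode]

theorem isMagicMatrix {n : ℕ} {u : Fin n → Fin n → H} (hu : IsMagicComatrix k u) :
    IsMagicMatrix u where
  row_mul := hu.row_mul
  -- The antipode reverses products and transposes the matrix, so it turns row relations into column
  -- relations.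
  col_mul i j l := by
    have h := congrArg (HopfAlgebra.antipode k) (hu.row_mul j l i)
    rw [HopfAlgebra.antipode_mul_antidistrib, hu.antipode, hu.antipode,
      apply_ite (HopfAlgebra.antipode k), hu.antipode, map_zero] at h
    rw [h]
    by_cases hil : i = l
    · simp [hil]
    · simp [hil, Ne.symm hil]
  row_sum := hu.row_sum
  col_sum i := by
    have h := congrArg (HopfAlgebra.antipode k) (hu.row_sum i)
    simpa only [map_sum, hu.antipode, HopfAlgebra.antipode_one] using h

end IsMagicComatrix

/-- The Hopf algebra `H` has a magic comatrix of size `n` whose entries generate a subalgebra that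
contains `A`. -/
def HasMagicComatrix {k : Type*} [Field k] {H : Type*} [Ring H] [HopfAlgebra k H]
    (n : ℕ) (A : Subalgebra k H) : Prop :=
  ∃ u : Fin n → Fin n → H, IsMagicComatrix k u ∧ A ≤ Algebra.adjoin k {a | ∃ i j, u i j = a}

namespace HasMagicComatrix

variable {k : Type*} [Field k] {H : Type*} [Ring H] [HopfAlgebra k H]

theorem of_isMagicComatrix {ι : Type*} [Fintype ι] [DecidableEq ι] {u : ι → ι → H}
    (hu : IsMagicComatrix k u) {A : Subalgebra k H}
    (hA : A ≤ Algebra.adjoin k {a | ∃ i j, u i j = a}) :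
    HasMagicComatrix (Fintype.card ι) A := by
  refine ⟨_, hu.reindex (Fintype.equivFin ι).symm, hA.trans (Algebra.adjoin_mono ?_)⟩
  rintro _ ⟨i, j, rfl⟩
  exact ⟨Fintype.equivFin ι i, Fintype.equivFin ι j, by simp⟩

/-- The block diagonal comatrix has the entries of both blocks among its own. This additivity is
what produces the degree bound. -/
theorem sup {n n' : ℕ} {A A' : Subalgebra k H} (h : HasMagicComatrix n A)
    (h' : HasMagicComatrix n' A') : HasMagicComatrix (n + n') (A ⊔ A') := by
  obtain ⟨u, hu, hA⟩ := h
  obtain ⟨v, hv, hA'⟩ := h'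
  have key := of_isMagicComatrix (hu.fromBlocks hv) (A := A ⊔ A') (sup_le
    (hA.trans (Algebra.adjoin_mono ?_)) (hA'.trans (Algebra.adjoin_mono ?_)))
  · simpa using key
  · rintro _ ⟨i, j, rfl⟩
    exact ⟨.inl i, .inl j, rfl⟩
  · rintro _ ⟨i, j, rfl⟩
    exact ⟨.inr i, .inr j, rfl⟩

theorem isQuotientOfQuantumPerm {n : ℕ} (h : HasMagicComatrix n (⊤ : Subalgebra k H)) :
    IsQuotientOfQuantumPerm k H n := by
  obtain ⟨u, hu, hA⟩ := h
  refine ⟨BialgHom.ofAlgHom (QuantumPerm.lift u hu.isMagicMatrix) ?_ ?_, ?_⟩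
  · refine QuantumPerm.algHom_ext fun i j => ?_
    simp [hu.counit, QuantumPerm.counit_u]
  · refine QuantumPerm.algHom_ext fun i j => ?_
    simp [hu.comul, QuantumPerm.comul_u]
  · refine (AlgHom.range_eq_top (QuantumPerm.lift u hu.isMagicMatrix)).mp ?_
    rw [eq_top_iff]
    refine hA.trans (Algebra.adjoin_le ?_)
    rintro _ ⟨i, j, rfl⟩
    exact ⟨QuantumPerm.u i j, QuantumPerm.lift_u _ _ i j⟩

end HasMagicComatrix

/-! ### Characters of finite abelian groups -/

section Characters

variable {k : Type*} [Field k] {G : Type*}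

-- The product χ⁻¹χ' is a homomorphism to kˣ, whose values sum to zero unless it is trivial.
-- Commutativity of G plays no role here, in contrast to the dual relation below.
open Classical in
theorem sum_char_inv_mul [Group G] [Fintype G] (χ χ' : G →* kˣ) :
    ∑ x, ((χ x⁻¹ : kˣ) : k) * (χ' x : k) = if χ = χ' then (Fintype.card G : k) else 0 := by
  have h := sum_hom_units ((Units.coeHom k).comp (χ⁻¹ * χ'))
  have h1 : (Units.coeHom k).comp (χ⁻¹ * χ') = 1 ↔ χ = χ' := by
    rw [← inv_mul_eq_one (a := χ)]
    constructor
    · intro h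
      ext x
      simpa using DFunLike.congr_fun h x
    · intro h
      rw [h]
      ext x
      simp
  simpa [h1] using h

variable [CommGroup G] [Fintype G]

open Classical in
theorem sum_char_apply [HasEnoughRootsOfUnity k (Monoid.exponent G)] [Fintype (G →* kˣ)] (x : G) :
    ∑ χ : G →* kˣ, (χ x : k) = if x = 1 then (Fintype.card G : k) else 0 := by
  have hc : Fintype.card (G →* kˣ) = Fintype.card G := by
    simpa using CommGroup.card_monoidHom_of_hasEnoughRootsOfUnity G k
  split_ifs with hx
  · simp [hx, hc]
  -- Some character φ has φ(x) ≠ 1; translating the sum by φ multiplies it by φ(x), so it vanishes.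
  · obtain ⟨φ, hφ⟩ := CommGroup.exists_apply_ne_one_of_hasEnoughRootsOfUnity G k hx
    have h := Fintype.sum_equiv (Equiv.mulLeft φ) (fun χ : G →* kˣ => (φ x : k) * (χ x : k))
      (fun χ => (χ x : k)) (fun χ => by simp)
    rw [← Finset.mul_sum] at h
    have h' : ((φ x : k) - 1) * ∑ χ : G →* kˣ, (χ x : k) = 0 := by rw [sub_mul, h]; ring
    refine (mul_eq_zero.mp h').resolve_left fun h0 => hφ ?_
    exact Units.ext (by simpa using sub_eq_zero.mp h0)

open Classical in
theorem sum_char_inv_apply_mul_apply [HasEnoughRootsOfUnity k (Monoid.exponent G)]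
    [Fintype (G →* kˣ)] (x y : G) :
    ∑ χ : G →* kˣ, ((χ x⁻¹ : kˣ) : k) * (χ y : k) = if x = y then (Fintype.card G : k) else 0 := by
  simpa [inv_mul_eq_one] using sum_char_apply (k := k) (x⁻¹ * y)

end Characters

/-! ### Generation by a small family of subgroups -/

/-- A finite group that is generated by a set `S` of subgroups is generated by fewer than `|F|`
members of `S`. -/
theorem exists_finset_sup_eq_top {F : Type*} [Group F] [Fintype F] (S : Set (Subgroup F))
    (hS : sSup S = ⊤) : ∃ s : Finset (Subgroup F), ↑s ⊆ S ∧ s.card + 1 ≤ Fintype.card F ∧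
      s.sup id = ⊤ := by
  classical
  -- Among the finite families with fewer members than the order of their join, take one whose join
  -- is largest. A member of S outside this join would raise the order by at least 1 and the
  -- cardinality by at most 1, contradicting maximality. The empty family starts the argument with 0
  -- + 1 ≤ 1.
  obtain ⟨s, ⟨hsS, hs⟩, hmax⟩ := Set.exists_max_image
    {s : Finset (Subgroup F) | ↑s ⊆ S ∧ s.card + 1 ≤ Nat.card (s.sup id : Subgroup F)}
    (fun s => Nat.card (s.sup id : Subgroup F)) (Set.toFinite _) ⟨∅, by simp⟩
  refine ⟨s, hsS, hs.trans ?_, ?_⟩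
  · rw [← Nat.card_eq_fintype_card]
    exact Subgroup.card_le_card_group _
  · rw [eq_top_iff, ← hS]
    refine sSup_le fun T hT => ?_
    by_contra hTs
    have hlt : s.sup id < (insert T s).sup id := by
      rw [Finset.sup_insert]
      exact right_lt_sup.mpr hTs
    have hcard : Nat.card (s.sup id : Subgroup F) <
        Nat.card ((insert T s).sup id : Subgroup F) :=
      Set.Finite.card_lt_card (Set.toFinite _) hlt
    refine absurd (hmax (insert T s) ⟨?_, ?_⟩) (not_le.mpr hcard)
    · rw [Finset.coe_insert]
      exact Set.insert_subset hT hsS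
    · have := Finset.card_insert_le T s
      omega

/-! ### Comatrices over the split extension -/

namespace SplitExtension

variable {k : Type*} [Field k] {F Γ : Type*} [Group F] [Group Γ] [Fintype Γ] {m : MatchedPair F Γ}

theorem antipode_e (g : Γ) (x : F) : HopfAlgebra.antipode k (e g x : SplitExtension k m) =
    e (m.ract g x)⁻¹ (m.lact g x)⁻¹ := by
  have h : HopfAlgebra.antipode k (A := SplitExtension k m) = antipodeLin k m := rfl
  rw [h, antipodeLin, linearLift_e]

open Classical in
/-- The translation action of `Γ` on itself, as a magic comatrix over `k^Γ ⊆ k^Γ # kF`. -/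
theorem isMagicComatrix_functions :
    IsMagicComatrix k fun g h : Γ => (e (g * h⁻¹) 1 : SplitExtension k m) where
  row_mul g h l := by
    simp [e_mul_e, m.ract_one]
  row_sum g := by
    rw [one_def]
    exact Fintype.sum_equiv ((Equiv.inv Γ).trans (Equiv.mulLeft g)) _ _ fun h => rfl
  comul g h := by
    rw [comul_e]
    refine Fintype.sum_equiv (Equiv.mulRight h) _ _ fun t => ?_
    simp [m.lact_one, mul_assoc]
  counit g h := by
    simp [counit_e, mul_inv_eq_one]
  antipode g h := by
    simp [antipode_e, m.ract_one, m.lact_one]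

/-- The element `1 # x = ∑_g e_g # x`. -/
noncomputable def ofGroup (k : Type*) [Field k] (m : MatchedPair F Γ) (x : F) :
    SplitExtension k m :=
  ∑ g, e g x

theorem ofGroup_one : ofGroup k m 1 = 1 := rfl

theorem ofGroup_mul (x y : F) : ofGroup k m (x * y) = ofGroup k m x * ofGroup k m y := by
  classical
  simp [ofGroup, Finset.sum_mul_sum, e_mul_e]

theorem e_one_mul_ofGroup (g : Γ) (x : F) : e g 1 * ofGroup k m x = e g x := by
  classical
  simp [ofGroup, Finset.mul_sum, e_mul_e, m.ract_one]

/-- Each basis vector factors as e_g # x = (e_g # 1)(1 # x). -/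
theorem eq_top_of_mem {A : Subalgebra k (SplitExtension k m)} (h1 : ∀ g, e g 1 ∈ A)
    (h2 : ∀ x, ofGroup k m x ∈ A) : A = ⊤ := by
  rw [eq_top_iff]
  rintro a -
  induction a using Finsupp.induction_linear with
  | zero => exact A.zero_mem
  | add a b ha hb => exact A.add_mem ha hb
  | single p r =>
    have h := A.smul_mem (A.mul_mem (h1 p.1) (h2 p.2)) r
    rw [e_one_mul_ofGroup] at h
    exact (Finsupp.smul_single_one p r) ▸ h

/-- The subgroup of all `x` such that `1 # x` belongs to the subalgebra `A`. -/
def groupPart [Finite F] (A : Subalgebra k (SplitExtension k m)) : Subgroup F where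
  carrier := {x | ofGroup k m x ∈ A}
  mul_mem' {x y} hx hy := by
    rw [Set.mem_ofPred_eq, ofGroup_mul]
    exact A.mul_mem hx hy
  one_mem' := by
    rw [Set.mem_ofPred_eq, ofGroup_one]
    exact A.one_mem
  inv_mem' {x} hx := by
    -- Since F is finite, x⁻¹ is a nonnegative power of x, so closure under products suffices.
    have hpow (n : ℕ) : ofGroup k m (x ^ n) = ofGroup k m x ^ n := by
      induction n with
      | zero => simp [ofGroup_one]
      | succ n ih => rw [pow_succ, ofGroup_mul, ih, pow_succ]
    rw [Set.mem_ofPred_eq, inv_eq_of_mul_eq_one_left (a := x ^ (orderOf x - 1)) (b := x) (by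
      rw [← pow_succ, Nat.sub_add_cancel (orderOf_pos x), pow_orderOf_eq_one]), hpow]
    exact A.pow_mem hx _

theorem mem_groupPart [Finite F] {A : Subalgebra k (SplitExtension k m)} {x : F} :
    x ∈ groupPart A ↔ ofGroup k m x ∈ A := Iff.rfl

/-! ### The coaction on the group algebra of an abelian stable subgroup -/

section Stable

variable {T : Subgroup F} (hT : m.IsStable T)

/-- The action of `Γ` on a stable subgroup. -/
def stableAct (s : Γ) (x : T) : T := ⟨m.lact s x, hT s x x.2⟩

omit [Fintype Γ] in
theorem stableAct_one (x : T) : stableAct hT 1 x = x := Subtype.ext (m.one_lact x)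

omit [Fintype Γ] in
theorem stableAct_stableAct (s t : Γ) (x : T) :
    stableAct hT s (stableAct hT t x) = stableAct hT (s * t) x :=
  Subtype.ext (m.mul_lact s t x).symm

omit [Fintype Γ] in
theorem stableAct_mul (s : Γ) (x y : T) :
    stableAct hT s (x * y) = stableAct hT s x * stableAct hT (m.ract s x) y :=
  Subtype.ext (m.lact_mul s x y)

omit [Fintype Γ] in
theorem stableAct_apply_one (s : Γ) : stableAct hT s 1 = 1 := Subtype.ext (m.lact_one s)

/-- The permutation `(t, x) ↦ ((t ◁ x)⁻¹, (t ▷ x)⁻¹)` of `Γ × T`. -/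
def antipodePerm : Equiv.Perm (Γ × T) :=
  Function.Involutive.toPerm (fun p => ((m.ract p.1 p.2)⁻¹, (stableAct hT p.1 p.2)⁻¹)) fun p => by
    refine Prod.ext ?_ (Subtype.ext ?_)
    · change (m.ract (m.ract p.1 p.2)⁻¹ (m.lact p.1 p.2)⁻¹)⁻¹ = p.1
      rw [← m.inv_ract p.1 p.2, ← m.ract_mul, mul_inv_cancel, m.ract_one, inv_inv]
    · change (m.lact (m.ract p.1 p.2)⁻¹ (m.lact p.1 p.2)⁻¹)⁻¹ = p.2
      rw [← m.lact_inv p.1 p.2, ← m.mul_lact, inv_mul_cancel, m.one_lact, inv_inv]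

variable [Fintype T]

/-- The matrix of the coaction of `k^Γ # kF` on `kT`, in the basis of primitive idempotents of `kT`
(which is indexed by the characters of `T`). -/
noncomputable def charMatrix (k : Type*) [Field k] (ψ χ : T →* kˣ) : SplitExtension k m :=
  ∑ t : Γ, ∑ x : T, ((Fintype.card T : k)⁻¹ * ((χ x⁻¹ : kˣ) * (ψ (stableAct hT t x) : kˣ))) •
    e t (x : F)

-- The product (e_t # x)(e_h # y) survives only for h = t ◁ x, and then the two values of ψ combine
-- to ψ(t ▷ xy). With z = xy fixed, the remaining sum over x is ∑ χ(x⁻¹)χ'(x), to which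
-- orthogonality applies.
open Classical in
theorem charMatrix_mul_charMatrix [CharZero k] (ψ χ χ' : T →* kˣ) :
    charMatrix hT k ψ χ * charMatrix hT k ψ χ' = if χ = χ' then charMatrix hT k ψ χ else 0 := by
  have h0 : (Fintype.card T : k) ≠ 0 := Nat.cast_ne_zero.mpr Fintype.card_ne_zero
  have h1 : charMatrix hT k ψ χ * charMatrix hT k ψ χ' = ∑ t : Γ, ∑ z : T, ∑ x : T,
      ((Fintype.card T : k)⁻¹ * (Fintype.card T : k)⁻¹ *
        ((χ x⁻¹ : kˣ) * (χ' x : kˣ)) *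
          ((χ' z⁻¹ : kˣ) * (ψ (stableAct hT t z) : kˣ))) • (e t (z : F) : SplitExtension k m) := by
    simp only [charMatrix, Finset.sum_mul]
    refine Finset.sum_congr rfl fun t _ => ?_
    rw [Finset.sum_comm (s := (Finset.univ : Finset T))]
    refine Finset.sum_congr rfl fun x _ => ?_
    simp only [Finset.mul_sum, smul_mul_smul_comm, e_mul_e]
    rw [Finset.sum_comm]
    simp only [smul_ite, smul_zero, Finset.sum_ite_eq, Finset.mem_univ, if_true]
    -- Substitution z = xy, with χ'(y⁻¹) = χ'(x)χ'(z⁻¹).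
    refine Fintype.sum_equiv (Equiv.mulLeft x) _ _ fun y => ?_
    simp only [Equiv.coe_mulLeft, Subgroup.coe_mul, stableAct_mul, map_mul, map_inv, mul_inv,
      Units.val_mul]
    congr 1
    rw [show ((χ' x : kˣ) : k) = ((χ' x)⁻¹⁻¹ : kˣ) by simp]
    field_simp
    simp
  rw [h1]
  simp only [← Finset.sum_smul, ← Finset.sum_mul, ← Finset.mul_sum, sum_char_inv_mul]
  split_ifs with h
  · subst h
    simp only [charMatrix, mul_assoc, inv_mul_cancel_left₀ h0]
  · simp

/-- Put (t', x') = ((t ◁ x)⁻¹, (t ▷ x)⁻¹). Then x'⁻¹ = t ▷ x and t' ▷ x' = x⁻¹, so reindexing by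
this involution exchanges the roles of ψ and χ. -/
theorem antipode_charMatrix (ψ χ : T →* kˣ) :
    HopfAlgebra.antipode k (charMatrix hT k ψ χ) = charMatrix hT k χ ψ := by
  simp only [charMatrix, map_sum, map_smul, antipode_e, ← Fintype.sum_prod_type']
  refine Fintype.sum_equiv (antipodePerm hT) _ _ fun p => ?_
  have h : stableAct hT (m.ract p.1 p.2)⁻¹ (stableAct hT p.1 p.2)⁻¹ = p.2⁻¹ := by
    refine inv_injective (Eq.trans ?_ (inv_inv _).symm)
    exact congrArg Prod.snd ((antipodePerm hT).symm_apply_apply p)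
  change _ = (_ * (((ψ (stableAct hT p.1 p.2)⁻¹⁻¹ : kˣ) : k) *
    (χ (stableAct hT (m.ract p.1 p.2)⁻¹ (stableAct hT p.1 p.2)⁻¹) : kˣ))) •
      e (m.ract p.1 p.2)⁻¹ (m.lact p.1 p.2)⁻¹
  rw [h, inv_inv, mul_comm (χ _ : k)]

open Classical in
theorem counit_charMatrix [CharZero k] (ψ χ : T →* kˣ) :
    Coalgebra.counit (R := k) (charMatrix hT k ψ χ) = if ψ = χ then 1 else 0 := by
  have h0 : (Fintype.card T : k) ≠ 0 := Nat.cast_ne_zero.mpr Fintype.card_ne_zero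
  simp only [charMatrix, map_sum, map_smul, counit_e, smul_eq_mul, mul_ite, mul_one, mul_zero]
  rw [Finset.sum_comm]
  simp only [Finset.sum_ite_eq', Finset.mem_univ, if_true, stableAct_one, ← Finset.mul_sum,
    sum_char_inv_mul, eq_comm (a := ψ)]
  split_ifs <;> simp [h0]

variable [CharZero k] [IsMulCommutative T] [HasEnoughRootsOfUnity k (Monoid.exponent T)]
  [Fintype (T →* kˣ)]

/-- Fourier inversion in the column index, where T must have enough characters. The case x = 1 gives
the row sums, ψ = 1 gives the elements 1 # x, and the general case gives the comultiplication. -/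
theorem sum_char_smul_charMatrix (ψ : T →* kˣ) (x : T) :
    ∑ χ : T →* kˣ, (χ x : k) • charMatrix hT k ψ χ =
      ∑ t : Γ, (ψ (stableAct hT t x) : k) • e t (x : F) := by
  classical
  let _ : CommGroup T := { (inferInstance : Group T) with mul_comm := mul_comm' }
  have h0 : (Fintype.card T : k) ≠ 0 := Nat.cast_ne_zero.mpr Fintype.card_ne_zero
  simp only [charMatrix, Finset.smul_sum, smul_smul]
  rw [Finset.sum_comm]
  refine Finset.sum_congr rfl fun t _ => ?_
  rw [Finset.sum_comm]
  have h (y : T) : ∑ χ : T →* kˣ, ((χ x : k) * ((Fintype.card T : k)⁻¹ *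
      ((χ y⁻¹ : kˣ) * (ψ (stableAct hT t y) : kˣ)))) • (e t (y : F) : SplitExtension k m) =
      if y = x then (ψ (stableAct hT t x) : k) • e t (x : F) else 0 := by
    have h2 : ∑ χ : T →* kˣ, ((χ x : k) * ((Fintype.card T : k)⁻¹ *
        ((χ y⁻¹ : kˣ) * (ψ (stableAct hT t y) : kˣ)))) =
        (Fintype.card T : k)⁻¹ * (ψ (stableAct hT t y) : kˣ) *
          ∑ χ : T →* kˣ, ((χ y⁻¹ : kˣ) : k) * (χ x : k) := by
      rw [Finset.mul_sum]
      exact Finset.sum_congr rfl fun χ _ => by ring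
    rw [← Finset.sum_smul, h2, sum_char_inv_apply_mul_apply y x]
    split_ifs with hyx
    · subst hyx
      rw [mul_right_comm, inv_mul_cancel₀ h0, one_mul]
    · simp
  simp only [h, Finset.sum_ite_eq', Finset.mem_univ, if_true]

theorem comul_charMatrix (ψ χ : T →* kˣ) :
    Coalgebra.comul (R := k) (charMatrix hT k ψ χ) =
      ∑ φ : T →* kˣ, charMatrix hT k ψ φ ⊗ₜ[k] charMatrix hT k φ χ := by
  have h1 (φ : T →* kˣ) : charMatrix hT k ψ φ ⊗ₜ[k] charMatrix hT k φ χ = ∑ t : Γ, ∑ x : T,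
      ((Fintype.card T : k)⁻¹ * (χ x⁻¹ : kˣ)) •
        (((φ (stableAct hT t x) : kˣ) : k) • charMatrix hT k ψ φ) ⊗ₜ[k]
          (e t (x : F) : SplitExtension k m) := by
    conv_lhs => rw [charMatrix.eq_def hT k φ χ]
    simp only [TensorProduct.tmul_sum, TensorProduct.tmul_smul, TensorProduct.smul_tmul',
      smul_smul, mul_assoc]
  simp only [h1]
  rw [Finset.sum_comm]
  simp only [Finset.sum_comm (s := (Finset.univ : Finset (T →* kˣ)))]
  -- Fourier inversion at the point t ▷ x removes the sum over the intermediate character φ.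
  simp only [← Finset.smul_sum, ← TensorProduct.sum_tmul, sum_char_smul_charMatrix]
  simp only [charMatrix, map_sum, map_smul, comul_e, stableAct_stableAct]
  simp only [TensorProduct.sum_tmul, Finset.smul_sum]
  rw [Finset.sum_comm]
  conv_rhs => rw [Finset.sum_comm]
  refine Finset.sum_congr rfl fun x _ => ?_
  rw [Finset.sum_comm]
  refine Finset.sum_congr rfl fun s _ => ?_
  -- Here t is the total group element and s the index of the right leg, so the left leg has index t
  -- s⁻¹.
  refine Fintype.sum_equiv (Equiv.mulRight s⁻¹) _ _ fun t => ?_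
  simp [stableAct, TensorProduct.smul_tmul', smul_smul, mul_assoc]

open Classical in
theorem isMagicComatrix_charMatrix : IsMagicComatrix k (charMatrix hT k) where
  row_mul := charMatrix_mul_charMatrix hT
  row_sum ψ := by
    have h := sum_char_smul_charMatrix hT ψ 1
    simpa [stableAct_apply_one, one_def] using h
  comul := comul_charMatrix hT
  counit := counit_charMatrix hT
  antipode := antipode_charMatrix hT

theorem ofGroup_mem_adjoin_charMatrix {x : F} (hx : x ∈ T) :
    ofGroup k m x ∈ Algebra.adjoin k {a | ∃ ψ χ, charMatrix hT k ψ χ = a} := by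
  have h := sum_char_smul_charMatrix (k := k) hT 1 ⟨x, hx⟩
  simp only [MonoidHom.one_apply, Units.val_one, one_smul] at h
  rw [ofGroup, ← h]
  exact Subalgebra.sum_mem _ fun χ _ =>
    Subalgebra.smul_mem _ (Algebra.subset_adjoin (by exact ⟨1, χ, rfl⟩)) _

end Stable

/-! ### Assembling the comatrices and bounding the degree -/

theorem hasMagicComatrix_functions : HasMagicComatrix (Fintype.card Γ)
    (Algebra.adjoin k {a : SplitExtension k m | ∃ g, e g 1 = a}) := by
  classical
  refine .of_isMagicComatrix isMagicComatrix_functions (Algebra.adjoin_mono ?_)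
  rintro _ ⟨g, rfl⟩
  exact ⟨g, 1, by simp⟩

theorem hasMagicComatrix_subgroup [IsAlgClosed k] [CharZero k] [Finite F] {T : Subgroup F}
    (hT : m.IsStable T) (hc : ∀ x ∈ T, ∀ y ∈ T, x * y = y * x) :
    HasMagicComatrix (Nat.card T)
      (Algebra.adjoin k {a : SplitExtension k m | ∃ x ∈ T, ofGroup k m x = a}) := by
  classical
  have : Fintype T := Fintype.ofFinite T
  have : IsMulCommutative T :=
    isMulCommutative_iff.mpr fun a b => Subtype.ext (hc a a.2 b b.2)
  let _ : CommGroup T := { (inferInstance : Group T) with mul_comm := mul_comm' }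
  have : NeZero (Monoid.exponent T) := ⟨Monoid.exponent_ne_zero_of_finite⟩
  have : NeZero (Monoid.exponent T : k) := NeZero.charZero
  have : HasEnoughRootsOfUnity k (Monoid.exponent T) := inferInstance
  -- A finite abelian group is isomorphic to its character group over k, so the comatrix has size
  -- |T|.
  obtain ⟨σ⟩ := CommGroup.monoidHom_mulEquiv_of_hasEnoughRootsOfUnity T k
  have : Fintype (T →* kˣ) := Fintype.ofEquiv T σ.symm.toEquiv
  rw [Nat.card_eq_fintype_card, ← Fintype.card_congr σ.toEquiv]
  refine .of_isMagicComatrix (isMagicComatrix_charMatrix (k := k) hT) (Algebra.adjoin_le ?_)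
  rintro _ ⟨x, hx, rfl⟩
  exact ofGroup_mem_adjoin_charMatrix hT hx

theorem hasMagicComatrix_finset [IsAlgClosed k] [CharZero k] [Finite F]
    (s : Finset (Subgroup F))
    (hs : ∀ T ∈ s, (∀ x ∈ T, ∀ y ∈ T, x * y = y * x) ∧ m.IsStable T) :
    HasMagicComatrix (Fintype.card Γ + ∑ T ∈ s, Nat.card T)
      (Algebra.adjoin k {a : SplitExtension k m | ∃ g, e g 1 = a} ⊔
        s.sup fun T => Algebra.adjoin k {a : SplitExtension k m | ∃ x ∈ T, ofGroup k m x = a}) := by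
  classical
  induction s using Finset.induction_on with
  | empty => simpa using hasMagicComatrix_functions
  | insert T s hTs ih =>
    have hT := hs T (Finset.mem_insert_self T s)
    have h := (ih fun T hT => hs T (Finset.mem_insert_of_mem hT)).sup
      (hasMagicComatrix_subgroup hT.2 hT.1)
    rw [Finset.sum_insert hTs, Finset.sup_insert]
    rwa [sup_assoc, sup_comm (s.sup _), add_assoc, add_comm (∑ T ∈ s, Nat.card T)] at h

theorem isQuantumPermutationAlgebra_of_sSup_eq_top [IsAlgClosed k] [CharZero k] [Fintype F]
    (h : sSup {T : Subgroup F | (∀ x ∈ T, ∀ y ∈ T, x * y = y * x) ∧ m.IsStable T} = ⊤) :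
    IsQuantumPermutationAlgebra k (SplitExtension k m) ∧
      quantumPermDegree k (SplitExtension k m) ≤ Fintype.card Γ * Fintype.card F ^ 2 := by
  obtain ⟨s, hs, hcard, hsup⟩ := exists_finset_sup_eq_top _ h
  have key := hasMagicComatrix_finset (k := k) (m := m) s fun T hT => hs hT
  have htop : Algebra.adjoin k {a : SplitExtension k m | ∃ g, e g 1 = a} ⊔ (s.sup fun T =>
      Algebra.adjoin k {a : SplitExtension k m | ∃ x ∈ T, ofGroup k m x = a}) = ⊤ := by
    refine eq_top_of_mem (fun g => ?_) fun x => ?_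
    · exact SetLike.le_def.mp le_sup_left (Algebra.subset_adjoin (by exact ⟨g, rfl⟩))
    -- The elements x with 1 # x in the generated algebra form a subgroup; it contains every T in s,
    -- hence all of F.
    · rw [← mem_groupPart]
      refine SetLike.le_def.mp (hsup.ge.trans (Finset.sup_le fun T hT y hy => ?_))
        (Subgroup.mem_top x)
      rw [mem_groupPart]
      refine SetLike.le_def.mp le_sup_right (SetLike.le_def.mp (Finset.le_sup (f := fun T =>
        Algebra.adjoin k {a : SplitExtension k m | ∃ x ∈ T, ofGroup k m x = a}) hT) ?_)
      exact Algebra.subset_adjoin (by exact ⟨y, hy, rfl⟩)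
  rw [htop] at key
  have hq := key.isQuotientOfQuantumPerm
  have hΓ : 1 ≤ Fintype.card Γ := Fintype.card_pos
  have h1 : 1 ≤ Fintype.card Γ + ∑ T ∈ s, Nat.card T := hΓ.trans (Nat.le_add_right _ _)
  refine ⟨⟨_, h1, hq⟩, le_trans (Nat.sInf_le (by exact ⟨h1, hq⟩)) ?_⟩
  have h2 : ∑ T ∈ s, Nat.card T ≤ s.card * Fintype.card F := by
    rw [← smul_eq_mul]
    refine Finset.sum_le_card_nsmul _ _ _ fun T _ => ?_
    rw [← Nat.card_eq_fintype_card]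
    exact Subgroup.card_le_card_group T
  have h3 : (s.card + 1) * Fintype.card F ≤ Fintype.card F ^ 2 := by
    rw [sq]
    exact Nat.mul_le_mul_right _ hcard
  have hF : 1 ≤ Fintype.card F := Fintype.card_pos
  rw [add_mul, one_mul] at h3
  have h4 : ∑ T ∈ s, Nat.card T + 1 ≤ Fintype.card F ^ 2 := by omega
  -- Write |Γ| = 1 + a. By `h4`, 1 plus the sum of the |T| is at most |F|², and a ≤ a|F|²; adding
  -- gives the bound.
  obtain ⟨a, ha⟩ := Nat.exists_eq_add_of_le hΓ
  rw [ha]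
  have h5 : a * 1 ≤ a * Fintype.card F ^ 2 := Nat.mul_le_mul_left a (by omega)
  linarith

/-! ### Cocentrality and triviality of the action -/

theorem rTensor_proj_comul_e (g : Γ) (x : F) :
    (proj k m).toCoalgHom.toLinearMap.rTensor _ (Coalgebra.comul (e g x)) =
      MonoidAlgebra.single (m.lact g x) (1 : k) ⊗ₜ[k] (e g x : SplitExtension k m) := by
  classical
  have h (a : SplitExtension k m) : (proj k m).toCoalgHom a = proj k m a := rfl
  simp [comul_e, h, proj_e, mul_inv_eq_one, TensorProduct.ite_tmul]

theorem rTensor_proj_comm_comul_e (g : Γ) (x : F) :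
    (proj k m).toCoalgHom.toLinearMap.rTensor _
      (TensorProduct.comm k _ _ (Coalgebra.comul (e g x))) =
      MonoidAlgebra.single x (1 : k) ⊗ₜ[k] (e g x : SplitExtension k m) := by
  classical
  have h (a : SplitExtension k m) : (proj k m).toCoalgHom a = proj k m a := rfl
  simp [comul_e, h, proj_e, TensorProduct.ite_tmul, m.one_lact]

/-- Applying π to the left leg of Δ(e_g # x) leaves only t = g, and to the right leg only t = 1.
Cocentrality therefore compares (g ▷ x) ⊗ (e_g # x) with x ⊗ (e_g # x). -/
theorem isCocentral_proj_iff :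
    IsCocentral (proj k m).toCoalgHom ↔ ∀ (s : Γ) (x : F), m.lact s x = x := by
  constructor
  · intro h s x
    have h1 := h (e s x)
    rw [rTensor_proj_comul_e, rTensor_proj_comm_comul_e] at h1
    -- The functional with value 1 on every basis vector cancels the common right factor.
    have h2 := congrArg (fun z => TensorProduct.rid k _
      ((linearLift fun _ _ => (1 : k) : SplitExtension k m →ₗ[k] k).lTensor _ z)) h1
    simp only [LinearMap.lTensor_tmul, linearLift_e, TensorProduct.rid_tmul, one_smul] at h2
    exact MonoidAlgebra.single_left_injective one_ne_zero h2
  · intro h a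
    have key : (proj k m).toCoalgHom.toLinearMap.rTensor (SplitExtension k m) ∘ₗ
        Coalgebra.comul = (proj k m).toCoalgHom.toLinearMap.rTensor (SplitExtension k m) ∘ₗ
          (TensorProduct.comm k _ _).toLinearMap ∘ₗ Coalgebra.comul := by
      refine linearMap_ext fun g x => ?_
      change (proj k m).toCoalgHom.toLinearMap.rTensor _ (Coalgebra.comul (e g x)) =
        (proj k m).toCoalgHom.toLinearMap.rTensor _
          (TensorProduct.comm k _ _ (Coalgebra.comul (e g x)))
      rw [rTensor_proj_comul_e, rTensor_proj_comm_comul_e, h]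
    exact congr($key a)

end SplitExtension

theorem theorem5p2 (k : Type*) [Field k] [IsAlgClosed k] [CharZero k]
    {F Γ : Type*} [Group F] [Group Γ] [Fintype F] [Fintype Γ] (m : MatchedPair F Γ) :
    -- `F` is generated by its abelian `Γ`-stable subgroups
    (sSup {T : Subgroup F | (∀ x ∈ T, ∀ y ∈ T, x * y = y * x) ∧ m.IsStable T} = ⊤ →
      IsQuantumPermutationAlgebra k (SplitExtension k m) ∧
        quantumPermDegree k (SplitExtension k m) ≤ Fintype.card Γ * Fintype.card F ^ 2) ∧
    -- `F` is abelian
    ((∀ x y : F, x * y = y * x) →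
      IsQuantumPermutationAlgebra k (SplitExtension k m) ∧
        quantumPermDegree k (SplitExtension k m) ≤ Fintype.card Γ * Fintype.card F ^ 2) ∧
    -- the extension is cocentral, that is, the action `▷` is trivial
    (IsCocentral (SplitExtension.proj k m).toCoalgHom ↔ ∀ (s : Γ) (x : F), m.lact s x = x) ∧
    (IsCocentral (SplitExtension.proj k m).toCoalgHom →
      IsQuantumPermutationAlgebra k (SplitExtension k m) ∧
        quantumPermDegree k (SplitExtension k m) ≤ Fintype.card Γ * Fintype.card F ^ 2) := by
  refine ⟨SplitExtension.isQuantumPermutationAlgebra_of_sSup_eq_top, fun hF => ?_,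
    SplitExtension.isCocentral_proj_iff, fun hc => ?_⟩
  · refine SplitExtension.isQuantumPermutationAlgebra_of_sSup_eq_top (eq_top_iff.mpr ?_)
    exact le_sSup ⟨fun x _ y _ => hF x y, fun _ _ _ => Subgroup.mem_top _⟩
  · rw [SplitExtension.isCocentral_proj_iff] at hc
    refine SplitExtension.isQuantumPermutationAlgebra_of_sSup_eq_top
      (eq_top_iff.mpr fun x _ => ?_)
    -- As ▷ is trivial, every subgroup is stable, and the cyclic ones are abelian and cover F.
    have hz : Subgroup.zpowers x ∈
        {T : Subgroup F | (∀ x ∈ T, ∀ y ∈ T, x * y = y * x) ∧ m.IsStable T} := by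
      refine ⟨fun y hy z hz => setLike_mul_comm hy hz,
        fun s y hy => ?_⟩
      rwa [hc]
    exact le_sSup hz (Subgroup.mem_zpowers x)
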